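/- **Theorem 1 (tree-structured graphs).** Let $G=(V,E)$ be a finite graph without cycles, let $\mathcal X=\{1,\dots,d\}$, and consider a pairwise Markov random field $p(x)\propto\prod_{u\in V}\psi_u(x_u)\prod_{(u,v)\in E}\psi_{uv}(x_u,x_v)$ on $\mathcal X^V$ with strictly positive potentials ($\psi_{uv}(a,b)=\psi_{vu}(b,a)$ for all $a,b\in\mathcal X$). Let $\vec E$ be the set of directed edges, $D=2|E|d$, and write a message vector as $m=(m_{uv}(i))_{(u\to v)\in\vec E,\,i\in\mathcal X}\in\mathbb R^D$. Put $M_{uv}(j)=\prod_{w\in N(u)\setminus\{v\}}m_{wu}(j)$. The belief propagation (BP) update $F:\mathbb R^D\to\mathbb R^D$ is $$F_{uv}(m)(i)=\kappa\sum_{j}\psi_{uv}(j,i)\,\psi_u(j)\,M_{uv}(j),$$ where $\kappa$ normalizes so that $\sum_iF_{uv}(m)(i)=1$ (with the convention that $F_{uv}(m)=0$ if the sum to be normalized vanishes). Let $\beta_{uv}(j)=\sum_i\psi_{uv}(j,i)\psi_u(j)$ and let $\Gamma_{uv}(\cdot,j)=\psi_{uv}(j,\cdot)\psi_u(j)/\beta_{uv}(j)$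 be the normalized columns. Stochastic belief propagation (SBP) with step sizes $\alpha^t$, started at a possibly random $m^0\in\mathbb R^D$, generates random messages as follows: for $t=0,1,\dots$ and every directed edge $(u\to v)$, given the history $\sigma(m^0,\dots,m^t)$ an index $J^{t+1}_{uv}\in\mathcal X$ is picked with probabilities $p^t_{uv}(j)\propto M^t_{uv}(j)\beta_{uv}(j)$, and $$m^{t+1}_{uv}=(1-\alpha^t)\,m^t_{uv}+\alpha^t\,\Gamma_{uv}(\cdot,J^{t+1}_{uv}).$$ (The initial message $m^0$ must be such that $p^0_{uv}$ is almost surely a probability vector, for example $m^0>0$.) Then $F$ has a unique fixed point $m^*\in\mathbb R^D$, and there is a matrix $A\in\mathbb R^{D\times D}$, depending only on the Markov random field, with $A^{r}=0$, where $r=\operatorname{diam}(G)$ is the number of edges of a longest path in $G$, such that every run of SBP with step size $\alpha^t=1/(t+1)$ satisfies: (a) $m^t\to m^*$ almost surely as $t\to\infty$; (b) for all $t=1,2,\dots$ the error $|m^t-m^*|$ is integrable and, elementwise, $$\mathbb E\,|m^t-m^*|\;\le\;4\,(I-2A)^{-1}\,\frac{\mathbf 1}{\sqrt t},$$ where $\mathbf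 1\in\mathbb R^D$ is the all-ones vector. -/

import Mathlib

open Filter Topology MeasureTheory
open scoped ProbabilityTheory Matrix

/-- The length (number of edges) of the longest path between any pair of nodes of `G`.
For a finite tree this is the usual diameter, see `longestPath_eq_diam`; on a finite forest it
is the largest diameter of a connected component. -/
noncomputable def longestPath {V : Type*} (G : SimpleGraph V) : ℕ :=
  sSup {k : ℕ | ∃ (u v : V) (p : G.Walk u v), p.IsPath ∧ p.length = k}

/-- On a finite tree, `longestPath` is the graph diameter of Mathlib. -/
theorem longestPath_eq_diam {V : Type*} [Fintype V] {G : SimpleGraph V} (hG : G.IsTree) :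
    longestPath G = G.diam := by
  classical
  have : Nonempty V := hG.connected.nonempty
  have htop : G.ediam ≠ ⊤ := SimpleGraph.connected_iff_ediam_ne_top.mp hG.connected
  apply le_antisymm
  · apply csSup_le
    · obtain ⟨u⟩ := hG.connected.nonempty
      exact ⟨0, u, u, SimpleGraph.Walk.nil, by simp, rfl⟩
    · rintro k ⟨u, v, p, hp, rfl⟩
      obtain ⟨q, hq, hql⟩ := hG.connected.exists_path_of_dist u v
      have h := (hG.isAcyclic.subsingleton_path u v).elim ⟨p, hp⟩ ⟨q, hq⟩
      have h' : p = q := congrArg Subtype.val h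
      rw [h', hql]
      exact SimpleGraph.dist_le_diam htop
  · obtain ⟨u, v, huv⟩ := G.exists_dist_eq_diam
    obtain ⟨q, hq, hql⟩ := hG.connected.exists_path_of_dist u v
    apply le_csSup
    · refine ⟨Fintype.card V, ?_⟩
      rintro k ⟨u, v, p, hp, rfl⟩
      exact hp.length_lt.le
    · exact ⟨u, v, q, hq, hql.trans huv⟩

/-- A pairwise Markov random field on the graph `G` with state space `X`, given by its strictly
positive compatibility functions: the joint distribution is proportional to
`∏ ψ_u(x_u) * ∏ ψ_uv(x_u, x_v)`, over the nodes `u` and the (undirected) edges `uv`.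
A dart `e` of `G` is a directed edge `u → v` with `u = e.fst` and `v = e.snd`, and
`edgePot e a b` is the value of the edge potential at `x_u = a`, `x_v = b`. The two directions of
an edge carry the same potential. -/
structure PairwiseMRF {V : Type*} (G : SimpleGraph V) (X : Type*) where
  nodePot : V → X → ℝ
  edgePot : G.Dart → X → X → ℝ
  nodePot_pos : ∀ u a, 0 < nodePot u a
  edgePot_pos : ∀ e a b, 0 < edgePot e a b
  edgePot_symm : ∀ e a b, edgePot e.symm b a = edgePot e a b

/-- The space `ℝ^D` of messages: one real number for each directed edge `u → v` and each state
of the receiving node `v`. -/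
abbrev Messages {V : Type*} (G : SimpleGraph V) (X : Type*) : Type _ := G.Dart × X → ℝ

namespace PairwiseMRF

variable {V : Type*} [Fintype V] [DecidableEq V] {G : SimpleGraph V} [DecidableRel G.Adj]
  {X : Type*} [Fintype X]

/-- The product `M_uv(j) = ∏ m_wu(j)` of the messages coming into `u`, over the neighbors
`w ≠ v` of `u`, for the directed edge `e = (u → v)`. -/
def inProd (m : Messages G X) (e : G.Dart) (j : X) : ℝ :=
  ∏ f : G.Dart with f.snd = e.fst ∧ f.fst ≠ e.snd, m (f, j)

/-- The right-hand side of the belief propagation update on `e = (u → v)` before normalization: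
`∑_j ψ_uv(j, i) ψ_u(j) M_uv(j)`. -/
def bpUnnormalized (ψ : PairwiseMRF G X) (m : Messages G X) (e : G.Dart) (i : X) : ℝ :=
  ∑ j, ψ.edgePot e j i * ψ.nodePot e.fst j * inProd m e j

/-- The global belief propagation update `F : ℝ^D → ℝ^D`: each outgoing message is normalized
so as to sum to one. -/
noncomputable def bpUpdate (ψ : PairwiseMRF G X) (m : Messages G X) : Messages G X :=
  fun k => ψ.bpUnnormalized m k.1 k.2 / ∑ i, ψ.bpUnnormalized m k.1 i

/-- The normalization constant `β_uv(j) = ∑_i ψ_uv(j, i) ψ_u(j)` of the column of the edge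
`e = (u → v)` that belongs to the state `j` of `u`. -/
def colSum (ψ : PairwiseMRF G X) (e : G.Dart) (j : X) : ℝ :=
  ∑ i, ψ.edgePot e j i * ψ.nodePot e.fst j

/-- The entry, at the state `i` of `v`, of the normalized column `Γ_uv(:, j)` of the edge
`e = (u → v)` that belongs to the state `j` of `u`. -/
noncomputable def normCol (ψ : PairwiseMRF G X) (e : G.Dart) (j i : X) : ℝ :=
  ψ.edgePot e j i * ψ.nodePot e.fst j / ψ.colSum e j

/-- The probability `p_uv(j) ∝ M_uv(j) β_uv(j)` with which stochastic belief propagation picks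
the index `j` on the directed edge `e = (u → v)`, when the current messages are `m`. -/
noncomputable def pickProb (ψ : PairwiseMRF G X) (m : Messages G X) (e : G.Dart) (j : X) : ℝ :=
  inProd m e j * ψ.colSum e j / ∑ l, inProd m e l * ψ.colSum e l

/-- The σ-field `σ(m⁰, …, mᵗ)` generated by the messages up to time `t`. -/
abbrev history {Ω : Type*} (m : ℕ → Ω → Messages G X) (t : ℕ) : MeasurableSpace Ω :=
  ⨆ s : ℕ, ⨆ _ : s ≤ t, MeasurableSpace.comap (m s) inferInstance

/-- `m⁰, m¹, …` is the sequence of messages, and `J t e` for `t ≥ 1` are the random indices, of a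
run of stochastic belief propagation with step sizes `α 0, α 1, …`. At time `t`, given the
history, the index `J (t + 1) e` is picked on the directed edge `e` with the probabilities
`pickProb`, and the message on `e` is moved by a step `α t` towards the normalized column of that
index. Nothing is assumed about the initial message (which may be random) beyond what
`cond_index` says for `t = 0`, namely that the quantities `pickProb` that it yields are
probabilities; nor about the joint law of the indices of different edges in the same round. -/
structure IsSBPRun (ψ : PairwiseMRF G X) (α : ℕ → ℝ) {Ω : Type*} [MeasurableSpace Ω]
    (μ : Measure Ω) (m : ℕ → Ω → Messages G X) (J : ℕ → G.Dart → Ω → X) : Prop where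
  measurable_messages : ∀ t, Measurable (m t)
  measurable_index : ∀ t e j, MeasurableSet (J (t + 1) e ⁻¹' {j})
  cond_index : ∀ t e j,
    μ⟦J (t + 1) e ⁻¹' {j} | history m t⟧ =ᵐ[μ] fun ω => ψ.pickProb (m t ω) e j
  update : ∀ t ω e i, m (t + 1) ω (e, i) =
    (1 - α t) * m t ω (e, i) + α t * ψ.normCol e (J (t + 1) e ω) i

end PairwiseMRF

set_option linter.unusedSectionVars false

/-! On a forest, stepping back from a directed edge to one that feeds it prolongs a path, so chains
of feeding edges are bounded in terms of `longestPath G`. Hence a matrix supported on feeding pairs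
is nilpotent (`pow_longestPath_eq_zero`), and facts about messages can be proved by induction along
the feeding relation (`dart_induction`).

The entries of the normalized columns lie in [c, 1] for some c > 0, and at positive messages the
update F is a convex combination of columns. So the box [c, 1]^D is invariant and contains every
fixed point. On this compact convex box F is C¹, hence Lipschitz; as each component sees only
feeding edges, |F m - F m'| ≤ A |m - m'| with A nonnegative and nilpotent (`exists_matrix_bound`).
Thus F^r is constant on the box, which gives the unique fixed point m*.

With step size 1/(t+1), t m^t is the sum of the first t picked columns, that is, a sum of martingale
differences bounded by 1 (the noise) plus ∑_{s<t} F(m^s). For (a), the averaged noise vanishes by a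
strong law (`ae_tendsto_sum_div`), and the averages of F(m^s) converge by Cesàro, inductively along
the feeding relation. For (b), the noise sum has mean absolute value at most √t, so e_t = E|m^t -
m*| satisfies t e_t ≤ √t + 1 + ∑_{1≤s<t} A e_s. Since ∑_{s≤t} 1/√s ≤ 2√t, induction gives e_t ≤ b/√t
with b = 2 + 2Ab, that is b = 2 (I - 2A)⁻¹ 1: half of the claimed bound. -/

/-- The directed edge `f = (w → u)` feeds `e = (u → v)` if `w ≠ v`: the message on `f` enters the
belief propagation update on `e`. -/
def Feeds {V : Type*} {G : SimpleGraph V} (f e : G.Dart) : Prop :=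
  f.snd = e.fst ∧ f.fst ≠ e.snd

/-- The directed edge `e` is the first step of a path with `n + 1` edges. -/
def StartsPath {V : Type*} {G : SimpleGraph V} (n : ℕ) (e : G.Dart) : Prop :=
  ∃ (v : V) (q : G.Walk e.snd v), (SimpleGraph.Walk.cons e.adj q).IsPath ∧ q.length = n

/-! ### Directed edges of a forest and nilpotency. -/

section Paths

variable {V : Type*} {G : SimpleGraph V}

theorem startsPath_zero (e : G.Dart) : StartsPath 0 e :=
  ⟨e.snd, SimpleGraph.Walk.nil, by simp [e.adj.ne], rfl⟩

/-- In an acyclic graph a walk is a path as soon as consecutive edges differ, and `f` followed by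
`e` does not backtrack. -/
theorem StartsPath.of_feeds (hG : G.IsAcyclic) {n : ℕ} {e f : G.Dart} (hfe : Feeds f e)
    (he : StartsPath n e) : StartsPath (n + 1) f := by
  obtain ⟨⟨w, u⟩, hf⟩ := f
  obtain ⟨⟨u', v⟩, he'⟩ := e
  obtain ⟨h1, h2⟩ := hfe
  obtain ⟨x, q, hq, hl⟩ := he
  simp only at h1 h2
  subst h1
  refine ⟨x, SimpleGraph.Walk.cons he' q, ?_, by simp [hl]⟩
  rw [hG.isPath_iff_isChain] at hq ⊢
  simp only [SimpleGraph.Walk.edges_cons, List.isChain_cons_cons] at hq ⊢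
  refine ⟨?_, hq⟩
  intro h
  rw [Sym2.eq_iff] at h
  rcases h with ⟨h, -⟩ | ⟨h, -⟩
  · exact hf.ne h
  · exact h2 h

theorem not_startsPath_longestPath [Fintype V] (e : G.Dart) :
    ¬ StartsPath (longestPath G) e := by
  rintro ⟨v, q, hq, hl⟩
  have h : longestPath G + 1 ≤ longestPath G := by
    refine le_csSup ⟨Fintype.card V, ?_⟩ ⟨_, v, _, hq, by simp [hl]⟩
    rintro k ⟨u, v, p, hp, rfl⟩
    exact hp.length_lt.le
  omega

/-- Induction along the directed edges of a finite forest. -/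
theorem dart_induction [Fintype V] (hG : G.IsAcyclic) {P : G.Dart → Prop}
    (h : ∀ e, (∀ f, Feeds f e → P f) → P e) (e : G.Dart) : P e := by
  by_contra he
  -- Every counterexample is fed by another one, so counterexamples start paths of every length.
  have key : ∀ n : ℕ, ∃ f : G.Dart, ¬ P f ∧ StartsPath n f := by
    intro n
    induction n with
    | zero => exact ⟨e, he, startsPath_zero e⟩
    | succ n ih =>
      obtain ⟨f, hf, hn⟩ := ih
      have : ∃ g, Feeds g f ∧ ¬ P g := by
        by_contra! hg
        exact hf (h f hg)
      obtain ⟨g, hgf, hg⟩ := this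
      exact ⟨g, hg, hn.of_feeds hG hgf⟩
  obtain ⟨f, -, hf⟩ := key (longestPath G)
  exact not_startsPath_longestPath f hf

/-- A matrix that is supported on the pairs of directed edges one of which feeds the other is
nilpotent on a finite forest. -/
theorem pow_longestPath_eq_zero [Fintype V] [DecidableEq V] [DecidableRel G.Adj]
    {X : Type*} [Fintype X] [DecidableEq X] (hG : G.IsAcyclic)
    (A : Matrix (G.Dart × X) (G.Dart × X) ℝ) (hA : ∀ k l, A k l ≠ 0 → Feeds l.1 k.1) :
    A ^ longestPath G = 0 := by
  -- A nonzero entry of `A ^ n` needs a chain of `n` feeding steps leading back from `k` to `l`.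
  have key : ∀ (n : ℕ) (k l : G.Dart × X), (A ^ n) k l ≠ 0 → StartsPath n l.1 := by
    intro n
    induction n with
    | zero => exact fun k l _ => startsPath_zero _
    | succ n ih =>
      intro k l h
      rw [pow_succ, Matrix.mul_apply] at h
      obtain ⟨x, -, hx⟩ := Finset.exists_ne_zero_of_sum_ne_zero h
      exact (ih k x (left_ne_zero_of_mul hx)).of_feeds hG (hA _ _ (right_ne_zero_of_mul hx))
  ext k l
  by_contra h
  exact not_startsPath_longestPath _ (key _ k l h)

end Paths

/-! ### The belief propagation update on a box of positive messages. -/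

namespace PairwiseMRF

variable {V : Type*} [Fintype V] [DecidableEq V] {G : SimpleGraph V} [DecidableRel G.Adj]
  {X : Type*} [Fintype X] (ψ : PairwiseMRF G X)

theorem weight_pos (e : G.Dart) (j i : X) : 0 < ψ.edgePot e j i * ψ.nodePot e.fst j :=
  mul_pos (ψ.edgePot_pos _ _ _) (ψ.nodePot_pos _ _)

theorem colSum_pos (e : G.Dart) (j : X) : 0 < ψ.colSum e j :=
  Finset.sum_pos (fun i _ => ψ.weight_pos e j i) ⟨j, Finset.mem_univ j⟩

theorem normCol_pos (e : G.Dart) (j i : X) : 0 < ψ.normCol e j i :=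
  div_pos (ψ.weight_pos e j i) (ψ.colSum_pos e j)

theorem normCol_le_one (e : G.Dart) (j i : X) : ψ.normCol e j i ≤ 1 :=
  div_le_one_of_le₀ (Finset.single_le_sum (f := fun i => ψ.edgePot e j i * ψ.nodePot e.fst j)
    (fun i _ => (ψ.weight_pos e j i).le) (Finset.mem_univ i)) (ψ.colSum_pos e j).le

/-- This supplies the lower end of the box [c, 1]^D; `c ≤ 1` makes the box nonempty. -/
theorem exists_pos_le_normCol :
    ∃ c : ℝ, 0 < c ∧ c ≤ 1 ∧ ∀ e j i, c ≤ ψ.normCol e j i := by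
  rcases isEmpty_or_nonempty (G.Dart × X × X) with h | h
  · exact ⟨1, one_pos, le_rfl, fun e j i => (h.false (e, j, i)).elim⟩
  · obtain ⟨⟨e, j, i⟩, hx⟩ := Finite.exists_min fun x : G.Dart × X × X => ψ.normCol x.1 x.2.1 x.2.2
    exact ⟨_, ψ.normCol_pos e j i, ψ.normCol_le_one e j i, fun e j i => hx (e, j, i)⟩

theorem bpUnnormalized_eq (m : Messages G X) (e : G.Dart) (i : X) :
    ψ.bpUnnormalized m e i = ∑ j, ψ.normCol e j i * (inProd m e j * ψ.colSum e j) := by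
  refine Finset.sum_congr rfl fun j _ => ?_
  have := (ψ.colSum_pos e j).ne'
  rw [normCol]
  field_simp

theorem sum_bpUnnormalized (m : Messages G X) (e : G.Dart) :
    ∑ i, ψ.bpUnnormalized m e i = ∑ j, inProd m e j * ψ.colSum e j := by
  simp only [bpUnnormalized, colSum, Finset.mul_sum]
  rw [Finset.sum_comm]
  exact Finset.sum_congr rfl fun j _ => Finset.sum_congr rfl fun i _ => mul_comm _ _

/-- The update is the mean of the normalized columns under the probabilities `pickProb`. -/
theorem bpUpdate_eq (m : Messages G X) (e : G.Dart) (i : X) :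
    ψ.bpUpdate m (e, i) = ∑ j, ψ.normCol e j i * ψ.pickProb m e j := by
  simp only [bpUpdate, pickProb, sum_bpUnnormalized]
  simp only [bpUnnormalized_eq, Finset.sum_div, mul_div_assoc]

theorem inProd_congr {m m' : Messages G X} {e : G.Dart}
    (h : ∀ f, Feeds f e → ∀ j, m (f, j) = m' (f, j)) (j : X) : inProd m e j = inProd m' e j :=
  Finset.prod_congr rfl fun f hf => h f (Finset.mem_filter.1 hf).2 j

theorem bpUpdate_congr {m m' : Messages G X} {e : G.Dart}
    (h : ∀ f, Feeds f e → ∀ j, m (f, j) = m' (f, j)) (i : X) :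
    ψ.bpUpdate m (e, i) = ψ.bpUpdate m' (e, i) := by
  simp only [bpUpdate_eq, pickProb, inProd_congr h]

theorem inProd_pos {m : Messages G X} {e : G.Dart} (h : ∀ f, Feeds f e → ∀ j, 0 < m (f, j))
    (j : X) : 0 < inProd m e j :=
  Finset.prod_pos fun f hf => h f (Finset.mem_filter.1 hf).2 j

theorem sum_inProd_mul_colSum_pos [Nonempty X] {m : Messages G X} {e : G.Dart}
    (h : ∀ f, Feeds f e → ∀ j, 0 < m (f, j)) : 0 < ∑ j, inProd m e j * ψ.colSum e j :=
  Finset.sum_pos (fun j _ => mul_pos (inProd_pos h j) (ψ.colSum_pos e j)) Finset.univ_nonempty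

/-- Positive feeding messages make `pickProb` a probability vector, so the update is a mean of
column entries. -/
theorem bpUpdate_mem_Icc {c : ℝ} (hc : ∀ e j i, c ≤ ψ.normCol e j i) {m : Messages G X}
    {e : G.Dart} (h : ∀ f, Feeds f e → ∀ j, 0 < m (f, j)) (i : X) :
    ψ.bpUpdate m (e, i) ∈ Set.Icc c 1 := by
  have : Nonempty X := ⟨i⟩
  have hD := ψ.sum_inProd_mul_colSum_pos h
  have hp : ∀ j, 0 ≤ ψ.pickProb m e j := fun j =>
    div_nonneg (mul_nonneg (inProd_pos h j).le (ψ.colSum_pos e j).le) hD.le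
  have hs : ∑ j, ψ.pickProb m e j = 1 := by
    simp only [pickProb, ← Finset.sum_div]
    exact div_self hD.ne'
  rw [bpUpdate_eq]
  constructor
  · calc c = ∑ j, c * ψ.pickProb m e j := by rw [← Finset.mul_sum, hs, mul_one]
      _ ≤ _ := Finset.sum_le_sum fun j _ => mul_le_mul_of_nonneg_right (hc e j i) (hp j)
  · calc _ ≤ ∑ j, 1 * ψ.pickProb m e j :=
          Finset.sum_le_sum fun j _ => mul_le_mul_of_nonneg_right (ψ.normCol_le_one e j i) (hp j)
      _ = 1 := by rw [← Finset.mul_sum, hs, mul_one]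

/-- No sign of `m` is assumed: an edge without feeders has the empty incoming product 1, and
positivity spreads from there along the feeding relation. -/
theorem mem_Icc_of_isFixedPt (hG : G.IsAcyclic) {c : ℝ} (hc0 : 0 < c)
    (hc : ∀ e j i, c ≤ ψ.normCol e j i) {m : Messages G X} (hm : ψ.bpUpdate m = m) :
    m ∈ Set.Icc (fun _ => c) (fun _ => (1 : ℝ)) := by
  have key : ∀ e, ∀ i, m (e, i) ∈ Set.Icc c 1 := by
    refine fun e => dart_induction hG (P := fun e => ∀ i, m (e, i) ∈ Set.Icc c 1) ?_ e
    intro e he i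
    rw [← hm]
    exact ψ.bpUpdate_mem_Icc hc (fun f hf j => hc0.trans_le (he f hf j).1) i
  exact ⟨fun k => (key k.1 k.2).1, fun k => (key k.1 k.2).2⟩

theorem contDiff_inProd (e : G.Dart) (j : X) :
    ContDiff ℝ 1 fun m : Messages G X => inProd m e j := by
  unfold inProd
  exact contDiff_prod fun f _ => contDiff_apply ℝ ℝ (f, j)

theorem continuous_inProd (e : G.Dart) (j : X) :
    Continuous fun m : Messages G X => inProd m e j :=
  (contDiff_inProd e j).continuous

theorem exists_lipschitzOnWith_bpUpdate {c : ℝ} (hc0 : 0 < c) :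
    ∃ L, LipschitzOnWith L ψ.bpUpdate
      (Set.Icc (fun _ => c) (fun _ => (1 : ℝ)) : Set (Messages G X)) := by
  refine ContDiffOn.exists_lipschitzOnWith (n := 1) ?_ one_ne_zero (convex_Icc _ _) isCompact_Icc
  rw [contDiffOn_pi]
  rintro ⟨e, i⟩
  simp only [bpUpdate_eq, pickProb]
  have : Nonempty X := ⟨i⟩
  refine ContDiffOn.sum fun j _ => contDiffOn_const.mul (ContDiffOn.div ?_ ?_ ?_)
  · exact ((contDiff_inProd e j).mul contDiff_const).contDiffOn
  · exact (ContDiff.sum fun j _ => (contDiff_inProd e j).mul contDiff_const).contDiffOn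
  · exact fun m hm => (ψ.sum_inProd_mul_colSum_pos fun f _ j => hc0.trans_le (hm.1 (f, j))).ne'

/-- Elementwise Lipschitz bound for the belief propagation update by a matrix that respects the
directed edges. -/
theorem exists_matrix_bound [DecidableEq X] {c : ℝ} (hc0 : 0 < c) :
    ∃ A : Matrix (G.Dart × X) (G.Dart × X) ℝ, (∀ k l, 0 ≤ A k l) ∧
      (∀ k l, A k l ≠ 0 → Feeds l.1 k.1) ∧
      ∀ m ∈ Set.Icc (fun _ => c) (fun _ => (1 : ℝ)), ∀ m' ∈ Set.Icc (fun _ => c) (fun _ => (1 : ℝ)),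
        ∀ k, |ψ.bpUpdate m k - ψ.bpUpdate m' k| ≤ (A *ᵥ fun l => |m l - m' l|) k := by
  classical
  obtain ⟨L, hL⟩ := ψ.exists_lipschitzOnWith_bpUpdate hc0
  refine ⟨Matrix.of fun k l => if Feeds l.1 k.1 then (L : ℝ) else 0, ?_, ?_, ?_⟩
  · intro k l
    simp only [Matrix.of_apply]
    split_ifs <;> simp
  · intro k l h
    by_contra h'
    simp [h'] at h
  · rintro m hm m' hm' ⟨e, i⟩
    -- The update on `e` cannot tell `m''` from `m'`, while `m''` differs from `m` only on feeding
    -- edges; so the global Lipschitz constant charges only those.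
    set m'' : Messages G X := fun l => if Feeds l.1 e then m' l else m l with hm''
    have h1 : ψ.bpUpdate m' (e, i) = ψ.bpUpdate m'' (e, i) :=
      ψ.bpUpdate_congr (fun f hf j => by simp [hm'', hf]) i
    have hmem : m'' ∈ Set.Icc (fun _ => c) (fun _ => (1 : ℝ)) := by
      constructor <;> intro l <;> simp only [hm''] <;> split_ifs
      exacts [hm'.1 l, hm.1 l, hm'.2 l, hm.2 l]
    have h2 : ∀ l, |m l - m'' l| = if Feeds l.1 e then |m l - m' l| else 0 := by
      intro l
      simp only [hm'']
      split_ifs <;> simp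
    have h3 : dist m m'' ≤ ∑ l, |m l - m'' l| := by
      rw [dist_pi_le_iff (Finset.sum_nonneg fun _ _ => abs_nonneg _)]
      intro l
      exact Finset.single_le_sum (f := fun l => |m l - m'' l|) (fun _ _ => abs_nonneg _)
        (Finset.mem_univ l)
    calc |ψ.bpUpdate m (e, i) - ψ.bpUpdate m' (e, i)|
        = dist (ψ.bpUpdate m (e, i)) (ψ.bpUpdate m'' (e, i)) := by rw [h1, Real.dist_eq]
      _ ≤ dist (ψ.bpUpdate m) (ψ.bpUpdate m'') := dist_le_pi_dist _ _ _
      _ ≤ L * dist m m'' := hL.dist_le_mul m hm m'' hmem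
      _ ≤ L * ∑ l, |m l - m'' l| := mul_le_mul_of_nonneg_left h3 L.2
      _ = _ := by
        simp only [Matrix.mulVec, dotProduct, Matrix.of_apply, h2, Finset.mul_sum]
        refine Finset.sum_congr rfl fun l _ => ?_
        split_ifs <;> simp

theorem mulVec_mono {ι : Type*} [Fintype ι] {A : Matrix ι ι ℝ} (hA : ∀ k l, 0 ≤ A k l)
    {v w : ι → ℝ} (h : ∀ k, v k ≤ w k) (k : ι) : (A *ᵥ v) k ≤ (A *ᵥ w) k :=
  Finset.sum_le_sum fun l _ => mul_le_mul_of_nonneg_left (h l) (hA k l)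

/-- A self-map of a set with an elementwise Lipschitz bound by a nilpotent nonnegative matrix has
a unique fixed point in that set. -/
theorem existsUnique_fixedPoint_of_nilpotent {ι : Type*} [Fintype ι] [DecidableEq ι]
    {A : Matrix ι ι ℝ} (hA : ∀ k l, 0 ≤ A k l) {r : ℕ} (hr : A ^ r = 0) {K : Set (ι → ℝ)}
    (hK : K.Nonempty) {F : (ι → ℝ) → ι → ℝ} (hF : Set.MapsTo F K K)
    (h : ∀ m ∈ K, ∀ m' ∈ K, ∀ k, |F m k - F m' k| ≤ (A *ᵥ fun l => |m l - m' l|) k) :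
    ∃ x ∈ K, F x = x ∧ ∀ y ∈ K, F y = y → y = x := by
  have hit : ∀ n : ℕ, ∀ m ∈ K, ∀ m' ∈ K, ∀ k,
      |F^[n] m k - F^[n] m' k| ≤ (A ^ n *ᵥ fun l => |m l - m' l|) k := by
    intro n
    induction n with
    | zero => intro m _ m' _ k; simp
    | succ n ih =>
      intro m hm m' hm' k
      rw [Function.iterate_succ_apply', Function.iterate_succ_apply', pow_succ',
        ← Matrix.mulVec_mulVec]
      exact (h _ (hF.iterate n hm) _ (hF.iterate n hm') k).trans
        (mulVec_mono hA (ih m hm m' hm') k)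
  have heq : ∀ m ∈ K, ∀ m' ∈ K, F^[r] m = F^[r] m' := by
    intro m hm m' hm'
    ext k
    have := hit r m hm m' hm' k
    rw [hr, Matrix.zero_mulVec] at this
    exact sub_eq_zero.1 (abs_nonpos_iff.1 this)
  obtain ⟨m, hm⟩ := hK
  refine ⟨F^[r] m, hF.iterate r hm, ?_, fun y hy hy' => ?_⟩
  · rw [← Function.iterate_succ_apply' F, Function.iterate_succ_apply]
    exact heq _ (hF hm) _ hm
  · rw [← heq y hy m hm]
    exact (Function.iterate_fixed hy' r).symm

/-- Convergence is required on the feeding edges only, which is what the induction hypothesis of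
`dart_induction` offers. -/
theorem tendsto_bpUpdate {m : ℕ → Messages G X} {x : Messages G X} {e : G.Dart}
    (hx : ∀ f, Feeds f e → ∀ j, 0 < x (f, j))
    (h : ∀ f, Feeds f e → ∀ j, Tendsto (fun t => m t (f, j)) atTop (𝓝 (x (f, j)))) (i : X) :
    Tendsto (fun t => ψ.bpUpdate (m t) (e, i)) atTop (𝓝 (ψ.bpUpdate x (e, i))) := by
  have : Nonempty X := ⟨i⟩
  have hp : ∀ j, Tendsto (fun t => inProd (m t) e j * ψ.colSum e j) atTop
      (𝓝 (inProd x e j * ψ.colSum e j)) := fun j =>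
    Tendsto.mul_const _ <| tendsto_finsetProd _ fun f hf => h f (Finset.mem_filter.1 hf).2 j
  simp only [bpUpdate_eq, pickProb]
  exact tendsto_finsetSum _ fun j _ => ((hp j).div (tendsto_finsetSum _ fun l _ => hp l)
    (ψ.sum_inProd_mul_colSum_pos hx).ne').const_mul _

theorem measurable_bpUpdate (k : G.Dart × X) :
    Measurable fun m : Messages G X => ψ.bpUpdate m k := by
  obtain ⟨e, i⟩ := k
  simp only [bpUpdate_eq, pickProb]
  exact Finset.measurable_sum _ fun j _ => (((continuous_inProd e j).measurable.mul_const _).div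
    (Finset.measurable_sum _ fun l _ => (continuous_inProd e l).measurable.mul_const _)).const_mul _

end PairwiseMRF

/-! ### Moment bounds and a strong law for bounded martingale differences. -/

section BoundedMartingaleDifferences

variable {Ω : Type*} {mΩ : MeasurableSpace Ω} {μ : Measure Ω} [IsProbabilityMeasure μ]
  {ℱ : Filtration ℕ mΩ} {Y : ℕ → Ω → ℝ}

theorem integrable_of_ae_abs_le {f : Ω → ℝ} (hf : Measurable f) {C : ℝ}
    (h : ∀ᵐ ω ∂μ, |f ω| ≤ C) : Integrable f μ :=
  Integrable.of_bound hf.aestronglyMeasurable C h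

theorem abs_sum_range_le {Y : ℕ → ℝ} (h : ∀ s, |Y s| ≤ 1) (n : ℕ) :
    |∑ s ∈ Finset.range n, Y s| ≤ n :=
  (Finset.abs_sum_le_sum_abs _ _).trans
    ((Finset.sum_le_sum fun s _ => h s).trans (by simp))

theorem integrable_sum_sq (hY : ∀ s, Measurable (Y s))
    (hbd : ∀ᵐ ω ∂μ, ∀ s, |Y s ω| ≤ 1) (n : ℕ) :
    Integrable (fun ω => (∑ s ∈ Finset.range n, Y s ω) ^ 2) μ := by
  refine integrable_of_ae_abs_le
    ((Finset.measurable_sum _ fun s _ => hY s).pow_const 2) (C := (n : ℝ) ^ 2) ?_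
  filter_upwards [hbd] with ω h
  rw [abs_pow]
  exact pow_le_pow_left₀ (abs_nonneg _) (abs_sum_range_le h n) 2

/-- Conditioning on `ℱ n` kills the cross term of the partial sum with `Y n`, so each new term adds
at most 1 to the second moment. -/
theorem integral_sq_sum_le (hY : ∀ s, Measurable[ℱ (s + 1)] (Y s))
    (hbd : ∀ᵐ ω ∂μ, ∀ s, |Y s ω| ≤ 1) (hmg : ∀ s, μ[Y s | ℱ s] =ᵐ[μ] 0) (n : ℕ) :
    ∫ ω, (∑ s ∈ Finset.range n, Y s ω) ^ 2 ∂μ ≤ n := by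
  have hYm : ∀ s, Measurable (Y s) := fun s => (hY s).mono (ℱ.le _) le_rfl
  have hS : ∀ n, Measurable[ℱ n] fun ω => ∑ s ∈ Finset.range n, Y s ω := fun n =>
    Finset.measurable_sum _ fun s hs =>
      (hY s).mono (ℱ.mono (Nat.succ_le_of_lt (Finset.mem_range.1 hs))) le_rfl
  have hSm : ∀ n, Measurable fun ω => ∑ s ∈ Finset.range n, Y s ω := fun n =>
    (hS n).mono (ℱ.le _) le_rfl
  have hSb : ∀ n, ∀ᵐ ω ∂μ, |∑ s ∈ Finset.range n, Y s ω| ≤ n := fun n => by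
    filter_upwards [hbd] with ω hω using abs_sum_range_le hω n
  have hYi : ∀ s, Integrable (Y s) μ := fun s =>
    integrable_of_ae_abs_le (hYm s) (hbd.mono fun ω h => h s)
  have hY2 : ∀ s, ∀ᵐ ω ∂μ, Y s ω ^ 2 ≤ 1 := fun s => by
    filter_upwards [hbd] with ω hω
    exact (sq_le_one_iff_abs_le_one _).2 (hω s)
  have hY2i : ∀ s, Integrable (fun ω => Y s ω ^ 2) μ := fun s =>
    integrable_of_ae_abs_le ((hYm s).pow_const 2) (C := 1) <| by
      filter_upwards [hY2 s] with ω h using by rwa [abs_of_nonneg (sq_nonneg _)]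
  have hS2i := integrable_sum_sq hYm hbd
  have hcr : ∀ n, Integrable (fun ω => (∑ s ∈ Finset.range n, Y s ω) * Y n ω) μ := fun n =>
    (hYi n).bdd_mul (hSm n).aestronglyMeasurable (hSb n)
  have hcr0 : ∀ n, ∫ ω, (∑ s ∈ Finset.range n, Y s ω) * Y n ω ∂μ = 0 := by
    intro n
    have h1 := condExp_mul_of_stronglyMeasurable_left (μ := μ) (m := ℱ n)
      (hS n).stronglyMeasurable (hcr n) (hYi n)
    have h2 := integral_condExp (μ := μ) (ℱ.le n)
      (f := (fun ω => ∑ s ∈ Finset.range n, Y s ω) * Y n)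
    calc _ = _ := h2.symm
      _ = ∫ ω, (0 : ℝ) ∂μ := by
        refine integral_congr_ae ?_
        filter_upwards [h1, hmg n] with ω h h'
        simp [h, h']
      _ = 0 := by simp
  induction n with
  | zero => simp
  | succ n ih =>
    have hexp : ∀ ω, (∑ s ∈ Finset.range (n + 1), Y s ω) ^ 2 =
        (∑ s ∈ Finset.range n, Y s ω) ^ 2 + 2 * ((∑ s ∈ Finset.range n, Y s ω) * Y n ω)
          + Y n ω ^ 2 := fun ω => by rw [Finset.sum_range_succ]; ring
    have hle : ∫ ω, Y n ω ^ 2 ∂μ ≤ 1 := by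
      simpa using integral_mono_ae (hY2i n) (integrable_const (1 : ℝ)) (hY2 n)
    simp only [hexp]
    rw [integral_add (f := fun ω => (∑ s ∈ Finset.range n, Y s ω) ^ 2 +
        2 * ((∑ s ∈ Finset.range n, Y s ω) * Y n ω))
        ((hS2i n).add ((hcr n).const_mul 2)) (hY2i n),
      integral_add (hS2i n) ((hcr n).const_mul 2), integral_const_mul, hcr0]
    push_cast
    linarith

theorem integral_abs_sum_le (hY : ∀ s, Measurable[ℱ (s + 1)] (Y s))
    (hbd : ∀ᵐ ω ∂μ, ∀ s, |Y s ω| ≤ 1) (hmg : ∀ s, μ[Y s | ℱ s] =ᵐ[μ] 0) (n : ℕ) :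
    ∫ ω, |∑ s ∈ Finset.range n, Y s ω| ∂μ ≤ √n := by
  have hYm : ∀ s, Measurable (Y s) := fun s => (hY s).mono (ℱ.le _) le_rfl
  rcases Nat.eq_zero_or_pos n with rfl | hn
  · simp
  have hsq : 0 < √(n : ℝ) := Real.sqrt_pos.2 (by exact_mod_cast hn)
  have hsq2 : √(n : ℝ) * √(n : ℝ) = n := Real.mul_self_sqrt n.cast_nonneg
  have hi := (integrable_sum_sq hYm hbd n).div_const (2 * √(n : ℝ))
  -- The inequality |x| ≤ x²/(2√n) + √n/2 plays the role of Cauchy–Schwarz.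
  calc ∫ ω, |∑ s ∈ Finset.range n, Y s ω| ∂μ
      ≤ ∫ ω, ((∑ s ∈ Finset.range n, Y s ω) ^ 2 / (2 * √(n : ℝ)) + √(n : ℝ) / 2) ∂μ := by
        refine integral_mono_of_nonneg (ae_of_all _ fun ω => abs_nonneg _)
          (hi.add (integrable_const _)) (ae_of_all _ fun ω => ?_)
        simp only
        rw [← sq_abs (∑ s ∈ Finset.range n, Y s ω)]
        set x := |∑ s ∈ Finset.range n, Y s ω|
        have : x ^ 2 / (2 * √(n : ℝ)) + √(n : ℝ) / 2 - x = (x - √(n : ℝ)) ^ 2 / (2 * √(n : ℝ)) := by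
          field_simp
          ring
        have h0 : 0 ≤ (x - √(n : ℝ)) ^ 2 / (2 * √(n : ℝ)) := by positivity
        linarith
    _ = (∫ ω, (∑ s ∈ Finset.range n, Y s ω) ^ 2 ∂μ) / (2 * √(n : ℝ)) + √(n : ℝ) / 2 := by
        rw [integral_add hi (integrable_const _), integral_div]
        simp
    _ ≤ n / (2 * √(n : ℝ)) + √(n : ℝ) / 2 := by
        gcongr
        exact integral_sq_sum_le hY hbd hmg n
    _ = √n := by
        nth_rewrite 1 [← hsq2]
        field_simp
        norm_num

/-- Adding `n` makes the partial sums monotone, as `Y s ≥ -1`. Ratios of consecutive squares tend to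
1, so for a monotone sequence the limit along squares extends to all `n`. -/
theorem tendsto_sum_div_of_sq {Y : ℕ → ℝ} (hbd : ∀ s, |Y s| ≤ 1)
    (h : Tendsto (fun n : ℕ => (∑ s ∈ Finset.range (n ^ 2), Y s) / (n ^ 2 : ℕ)) atTop (𝓝 0)) :
    Tendsto (fun n : ℕ => (∑ s ∈ Finset.range n, Y s) / n) atTop (𝓝 0) := by
  have hmono : Monotone fun n : ℕ => (∑ s ∈ Finset.range n, Y s) + n := by
    refine monotone_nat_of_le_succ fun n => ?_
    rw [Finset.sum_range_succ]
    push_cast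
    linarith [(abs_le.1 (hbd n)).1]
  have key := tendsto_div_of_monotone_of_exists_subseq_tendsto_div _ 1 hmono fun a ha => by
    refine ⟨fun n => n ^ 2, ?_, tendsto_pow_atTop two_ne_zero, ?_⟩
    · have h1 : Tendsto (fun n : ℕ => (1 + 1 / (n : ℝ)) ^ 2) atTop (𝓝 1) := by
        simpa using (tendsto_one_div_atTop_nhds_zero_nat (𝕜 := ℝ)).const_add 1 |>.pow 2
      filter_upwards [h1.eventually_le_const ha, eventually_gt_atTop 0] with n hn hn0
      have hn0' : (0 : ℝ) < n := by exact_mod_cast hn0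
      have : ((n : ℝ) + 1) ^ 2 = (1 + 1 / (n : ℝ)) ^ 2 * (n : ℝ) ^ 2 := by
        field_simp
      push_cast
      rw [this]
      gcongr
    · have h1 := h.add_const 1
      rw [zero_add] at h1
      refine h1.congr' ?_
      filter_upwards [eventually_gt_atTop 0] with n hn
      have : ((n ^ 2 : ℕ) : ℝ) ≠ 0 := by positivity
      rw [add_div, div_self this]
  have key' := key.sub_const 1
  rw [sub_self] at key'
  refine key'.congr' ?_
  filter_upwards [eventually_gt_atTop 0] with n hn
  have : (n : ℝ) ≠ 0 := by positivity
  rw [add_div, div_self this, add_sub_cancel_right]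

/-- Strong law of large numbers for bounded martingale differences. -/
theorem ae_tendsto_sum_div (hY : ∀ s, Measurable[ℱ (s + 1)] (Y s))
    (hbd : ∀ᵐ ω ∂μ, ∀ s, |Y s ω| ≤ 1) (hmg : ∀ s, μ[Y s | ℱ s] =ᵐ[μ] 0) :
    ∀ᵐ ω ∂μ, Tendsto (fun n : ℕ => (∑ s ∈ Finset.range n, Y s ω) / n) atTop (𝓝 0) := by
  have hYm : ∀ s, Measurable (Y s) := fun s => (hY s).mono (ℱ.le _) le_rfl
  -- Along squares the second moments of the averages are at most 1/n², hence summable, and `Z n →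
  -- 0` almost surely.
  set Z : ℕ → Ω → ℝ := fun n ω => ((∑ s ∈ Finset.range (n ^ 2), Y s ω) / (n ^ 2 : ℕ)) ^ 2 with hZ
  have hZi : ∀ n, Integrable (Z n) μ := fun n => by
    simp only [hZ, div_pow]
    exact (integrable_sum_sq hYm hbd _).div_const _
  have hZle : ∀ n, ∫ ω, Z n ω ∂μ ≤ 1 / (n : ℝ) ^ 2 := by
    intro n
    simp only [hZ, div_pow]
    rw [integral_div]
    rcases Nat.eq_zero_or_pos n with rfl | hn
    · simp
    have hn' : (0 : ℝ) < n := by exact_mod_cast hn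
    calc _ ≤ ((n ^ 2 : ℕ) : ℝ) / ((n ^ 2 : ℕ) : ℝ) ^ 2 := by
          gcongr
          exact integral_sq_sum_le hY hbd hmg _
      _ = _ := by
          push_cast
          field_simp
  have hsum : ∀ᵐ ω ∂μ, Summable fun n => ‖Z n ω‖ := by
    refine summable_norm_of_tsum_eLpNorm_ne_top le_rfl (fun n => (hZi n).1) ?_
    have hle : ∀ n, eLpNorm (Z n) 1 μ ≤ ENNReal.ofReal (1 / (n : ℝ) ^ 2) := by
      intro n
      rw [eLpNorm_one_eq_lintegral_enorm, ← ofReal_integral_norm_eq_lintegral_enorm (hZi n)]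
      refine ENNReal.ofReal_le_ofReal (le_trans (le_of_eq ?_) (hZle n))
      exact integral_congr_ae (ae_of_all _ fun ω => Real.norm_of_nonneg (sq_nonneg _))
    refine ne_top_of_le_ne_top ?_ (ENNReal.tsum_le_tsum hle)
    exact (Real.summable_one_div_nat_pow.2 one_lt_two).tsum_ofReal_ne_top
  filter_upwards [hsum, hbd] with ω hω hb
  refine tendsto_sum_div_of_sq hb ?_
  have h0 : Tendsto (fun n => Z n ω) atTop (𝓝 0) := hω.of_norm.tendsto_atTop_zero
  have h1 := h0.sqrt
  simp only [hZ, Real.sqrt_sq_eq_abs, Real.sqrt_zero] at h1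
  exact (tendsto_zero_iff_abs_tendsto_zero _).2 h1

end BoundedMartingaleDifferences

/-! ### Solving the recursion for the mean error. -/

section ErrorRecursion

variable {ι : Type*} [Fintype ι] [DecidableEq ι]

theorem inv_one_sub_eq_geom_sum {A : Matrix ι ι ℝ} {r : ℕ} (hr : A ^ r = 0) :
    (1 - A)⁻¹ = ∑ i ∈ Finset.range r, A ^ i :=
  Matrix.inv_eq_right_inv (by rw [mul_neg_geom_sum, hr, sub_zero])

theorem sum_Ico_one_div_sqrt_le (t : ℕ) :
    ∑ s ∈ Finset.Ico 1 (t + 1), 1 / √(s : ℝ) ≤ 2 * √(t : ℝ) := by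
  induction t with
  | zero => simp
  | succ t ih =>
    rw [Finset.sum_Ico_succ_top (by omega)]
    push_cast
    have h0 : 0 < √((t : ℝ) + 1) := Real.sqrt_pos.2 (by positivity)
    have h1 : √((t : ℝ) + 1) * √((t : ℝ) + 1) = t + 1 := Real.mul_self_sqrt (by positivity)
    have h2 : √(t : ℝ) * √(t : ℝ) = t := Real.mul_self_sqrt t.cast_nonneg
    have h3 : 1 / √((t : ℝ) + 1) ≤ 2 * √((t : ℝ) + 1) - 2 * √(t : ℝ) := by
      rw [div_le_iff₀ h0]
      nlinarith [sq_nonneg (√((t : ℝ) + 1) - √(t : ℝ))]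
    linarith

/-- The bound `c / √s` reproduces itself: the earlier errors contribute at most 2√t (A c), and √t +
1 ≤ 2√t, which together make √t c. -/
theorem error_le_of_recursion {A : Matrix ι ι ℝ} (hA : ∀ k l, 0 ≤ A k l) {c : ι → ℝ}
    (hc0 : ∀ k, 0 ≤ c k) (hc : ∀ k, c k = 2 + 2 * (A *ᵥ c) k) {e : ℕ → ι → ℝ}
    (he : ∀ t : ℕ, 1 ≤ t → ∀ k,
      t * e t k ≤ √(t : ℝ) + 1 + ∑ s ∈ Finset.Ico 1 t, (A *ᵥ e s) k)
    (t : ℕ) (ht : 1 ≤ t) (k : ι) : e t k ≤ c k / √(t : ℝ) := by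
  induction t using Nat.strong_induction_on generalizing k with
  | _ t ih =>
    have ht' : (1 : ℝ) ≤ t := by exact_mod_cast ht
    have h1 : 1 ≤ √(t : ℝ) := Real.one_le_sqrt.2 ht'
    have h0 : 0 < √(t : ℝ) := one_pos.trans_le h1
    have hAc : 0 ≤ (A *ᵥ c) k := Finset.sum_nonneg fun l _ => mul_nonneg (hA k l) (hc0 l)
    have hsum : ∑ s ∈ Finset.Ico 1 t, (A *ᵥ e s) k ≤ (A *ᵥ c) k * (2 * √(t : ℝ)) :=
      calc ∑ s ∈ Finset.Ico 1 t, (A *ᵥ e s) k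
          ≤ ∑ s ∈ Finset.Ico 1 t, (A *ᵥ c) k * (1 / √(s : ℝ)) := by
            refine Finset.sum_le_sum fun s hs => ?_
            rw [Finset.mem_Ico] at hs
            refine (PairwiseMRF.mulVec_mono hA (ih s hs.2 hs.1) k).trans (le_of_eq ?_)
            simp only [Matrix.mulVec, dotProduct, Finset.sum_mul]
            exact Finset.sum_congr rfl fun l _ => by ring
        _ = (A *ᵥ c) k * ∑ s ∈ Finset.Ico 1 t, 1 / √(s : ℝ) := by rw [Finset.mul_sum]
        _ ≤ _ := mul_le_mul_of_nonneg_left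
          ((Finset.sum_le_sum_of_subset_of_nonneg (Finset.Ico_subset_Ico_right t.le_succ)
            fun s _ _ => by positivity).trans (sum_Ico_one_div_sqrt_le t)) hAc
    have hsq : √(t : ℝ) * √(t : ℝ) = t := Real.mul_self_sqrt t.cast_nonneg
    rw [le_div_iff₀ h0]
    have h2 := he t ht k
    refine le_of_mul_le_mul_left ?_ h0
    rw [hc k]
    calc √(t : ℝ) * (e t k * √(t : ℝ)) = √(t : ℝ) * √(t : ℝ) * e t k := by ring
      _ = t * e t k := by rw [hsq]
      _ ≤ _ := by nlinarith

end ErrorRecursion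

/-! ### Runs of stochastic belief propagation. -/

namespace PairwiseMRF

variable {V : Type*} [Fintype V] [DecidableEq V] {G : SimpleGraph V} [DecidableRel G.Adj]
  {X : Type*} [Fintype X] {ψ : PairwiseMRF G X}

section History

variable {Ω : Type*} {mΩ : MeasurableSpace Ω} {m : ℕ → Ω → Messages G X}

/-- The filtration of the σ-fields `history m t`. -/
def historyFiltration (hm : ∀ t, Measurable (m t)) : Filtration ℕ mΩ where
  seq := history m
  mono' _ _ hst := iSup₂_le fun i hi => le_iSup₂_of_le i (hi.trans hst) le_rfl
  le' _ := iSup₂_le fun i _ => (hm i).comap_le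

theorem measurable_history (hm : ∀ t, Measurable (m t)) {s t : ℕ} (hst : s ≤ t) :
    Measurable[historyFiltration hm t] (m s) :=
  measurable_iff_comap_le.2 (le_iSup₂_of_le (f := fun i (_ : i ≤ t) =>
    MeasurableSpace.comap (m i) inferInstance) s hst le_rfl)

end History

namespace IsSBPRun

variable {Ω : Type*} [mΩ : MeasurableSpace Ω] {μ : Measure Ω} [IsProbabilityMeasure μ]
  {α : ℕ → ℝ} {m : ℕ → Ω → Messages G X} {J : ℕ → G.Dart → Ω → X}

/-- The picking probabilities make the random column an unbiased estimate of the update. -/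
theorem condExp_normCol (h : ψ.IsSBPRun α μ m J) (s : ℕ) (e : G.Dart) (i : X) :
    μ[fun ω => ψ.normCol e (J (s + 1) e ω) i | history m s] =ᵐ[μ]
      fun ω => ψ.bpUpdate (m s ω) (e, i) := by
  classical
  have h1 : (fun ω => ψ.normCol e (J (s + 1) e ω) i) =
      ∑ j, ψ.normCol e j i • (J (s + 1) e ⁻¹' {j}).indicator (fun _ => (1 : ℝ)) := by
    ext ω
    simp [Set.indicator_apply]
  rw [h1]
  have hint : ∀ j, Integrable ((J (s + 1) e ⁻¹' {j}).indicator (fun _ => (1 : ℝ))) μ := fun j =>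
    (integrable_const 1).indicator (h.measurable_index s e j)
  have h2 := condExp_finsetSum (μ := μ) (s := Finset.univ)
    (fun j _ => (hint j).smul (ψ.normCol e j i)) (history m s)
  have h3 : ∀ᵐ ω ∂μ, ∀ j, (μ[ψ.normCol e j i • (J (s + 1) e ⁻¹' {j}).indicator (fun _ => (1 : ℝ)) |
      history m s]) ω = ψ.normCol e j i * ψ.pickProb (m s ω) e j := by
    rw [ae_all_iff]
    intro j
    filter_upwards [condExp_smul (μ := μ) (ψ.normCol e j i)
      ((J (s + 1) e ⁻¹' {j}).indicator (fun _ => (1 : ℝ))) (history m s),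
      h.cond_index s e j] with ω h h'
    rw [h, Pi.smul_apply, h', smul_eq_mul]
  filter_upwards [h2, h3] with ω h h'
  rw [h, Finset.sum_apply, bpUpdate_eq]
  exact Finset.sum_congr rfl fun j _ => h' j

theorem measurable_normCol (h : ψ.IsSBPRun α μ m J) (s : ℕ) (e : G.Dart) (i : X) :
    Measurable fun ω => ψ.normCol e (J (s + 1) e ω) i := by
  classical
  have h1 : (fun ω => ψ.normCol e (J (s + 1) e ω) i) = fun ω =>
      ∑ j, (J (s + 1) e ⁻¹' {j}).indicator (fun _ => ψ.normCol e j i) ω := by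
    ext ω
    simp [Set.indicator_apply]
  rw [h1]
  exact Finset.measurable_sum _ fun j _ => measurable_const.indicator (h.measurable_index s e j)

theorem integrable_normCol (h : ψ.IsSBPRun α μ m J) (s : ℕ) (e : G.Dart) (i : X) :
    Integrable (fun ω => ψ.normCol e (J (s + 1) e ω) i) μ :=
  integrable_of_ae_abs_le (h.measurable_normCol s e i) (C := 1) <| ae_of_all _ fun ω => by
    rw [abs_of_pos (ψ.normCol_pos _ _ _)]
    exact ψ.normCol_le_one _ _ _

/-- The update is a conditional expectation of a quantity in [0, 1]. This covers `s = 0`, where the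
initial message may lie outside the box. -/
theorem ae_bpUpdate_mem_Icc (h : ψ.IsSBPRun α μ m J) (s : ℕ) (k : G.Dart × X) :
    ∀ᵐ ω ∂μ, ψ.bpUpdate (m s ω) k ∈ Set.Icc (0 : ℝ) 1 := by
  have hle : history m s ≤ mΩ := (historyFiltration h.measurable_messages).le s
  have h0 := condExp_mono (μ := μ) (m := history m s) (integrable_const (0 : ℝ))
    (h.integrable_normCol s k.1 k.2) (ae_of_all _ fun ω => (ψ.normCol_pos _ _ _).le)
  have h1 := condExp_mono (μ := μ) (m := history m s) (h.integrable_normCol s k.1 k.2)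
    (integrable_const (1 : ℝ)) (ae_of_all _ fun ω => ψ.normCol_le_one _ _ _)
  rw [condExp_const hle] at h0 h1
  filter_upwards [h0, h1, h.condExp_normCol s k.1 k.2] with ω a b c
  rw [c] at a b
  exact ⟨a, b⟩

section Noise

variable (ψ m J) in
/-- The noise in the step from time `s` to time `s + 1`. -/
noncomputable def noise (k : G.Dart × X) (s : ℕ) (ω : Ω) : ℝ :=
  ψ.normCol k.1 (J (s + 1) k.1 ω) k.2 - ψ.bpUpdate (m s ω) k

theorem measurable_bpUpdate_history (h : ψ.IsSBPRun α μ m J) (k : G.Dart × X) (s : ℕ) :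
    Measurable[historyFiltration h.measurable_messages s] fun ω => ψ.bpUpdate (m s ω) k :=
  (ψ.measurable_bpUpdate k).comp (measurable_history h.measurable_messages le_rfl)

theorem ae_abs_noise_le (h : ψ.IsSBPRun α μ m J) (k : G.Dart × X) :
    ∀ᵐ ω ∂μ, ∀ s, |noise ψ m J k s ω| ≤ 1 := by
  rw [ae_all_iff]
  intro s
  filter_upwards [h.ae_bpUpdate_mem_Icc s k] with ω hω
  exact abs_sub_le_of_nonneg_of_le (ψ.normCol_pos _ _ _).le (ψ.normCol_le_one _ _ _) hω.1 hω.2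

theorem condExp_noise (h : ψ.IsSBPRun α μ m J) (k : G.Dart × X) (s : ℕ) :
    μ[noise ψ m J k s | historyFiltration h.measurable_messages s] =ᵐ[μ] 0 := by
  set ℱ := historyFiltration h.measurable_messages
  have hm := h.measurable_bpUpdate_history k s
  have hi : Integrable (fun ω => ψ.bpUpdate (m s ω) k) μ :=
    integrable_of_ae_abs_le (hm.mono (ℱ.le s) le_rfl) (C := 1) <| by
      filter_upwards [h.ae_bpUpdate_mem_Icc s k] with ω hω
      rw [abs_of_nonneg hω.1]
      exact hω.2
  have h1 := condExp_sub (h.integrable_normCol s k.1 k.2) hi (ℱ s)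
  rw [condExp_of_stronglyMeasurable (ℱ.le s) hm.stronglyMeasurable hi] at h1
  filter_upwards [h1, h.condExp_normCol s k.1 k.2] with ω a b
  refine a.trans ?_
  rw [Pi.sub_apply]
  exact sub_eq_zero.2 b

end Noise

section HarmonicSteps

variable (h : ψ.IsSBPRun (fun t : ℕ => 1 / ((t : ℝ) + 1)) μ m J)
include h

theorem mul_message_succ (t : ℕ) (ω : Ω) (k : G.Dart × X) :
    ((t : ℝ) + 1) * m (t + 1) ω k = t * m t ω k + ψ.normCol k.1 (J (t + 1) k.1 ω) k.2 := by
  rw [h.update t ω k.1 k.2]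
  field_simp
  ring

/-- The first step has size 1 and erases the initial message; from then on the message is the
average of the picked columns. -/
theorem mul_message (t : ℕ) (ω : Ω) (k : G.Dart × X) :
    t * m t ω k = ∑ s ∈ Finset.range t, ψ.normCol k.1 (J (s + 1) k.1 ω) k.2 := by
  induction t with
  | zero => simp
  | succ t ih =>
    rw [Finset.sum_range_succ, ← ih, ← h.mul_message_succ]
    push_cast
    rfl

theorem mul_message_eq_noise_add (t : ℕ) (ω : Ω) (k : G.Dart × X) :
    t * m t ω k = ∑ s ∈ Finset.range t, noise ψ m J k s ω
      + ∑ s ∈ Finset.range t, ψ.bpUpdate (m s ω) k := by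
  rw [h.mul_message, ← Finset.sum_add_distrib]
  exact Finset.sum_congr rfl fun s _ => (sub_add_cancel _ _).symm

theorem message_mem_Icc {c : ℝ} (hc : ∀ e j i, c ≤ ψ.normCol e j i) {t : ℕ} (ht : 1 ≤ t) (ω : Ω) :
    m t ω ∈ Set.Icc (fun _ => c) (fun _ => (1 : ℝ)) := by
  have ht' : (0 : ℝ) < t := by exact_mod_cast ht
  refine ⟨fun k => ?_, fun k => ?_⟩ <;> refine le_of_mul_le_mul_left ?_ ht' <;>
    rw [h.mul_message]
  · simpa using Finset.card_nsmul_le_sum (Finset.range t) _ c fun s _ => hc k.1 (J (s + 1) k.1 ω) k.2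
  · simpa using Finset.sum_le_card_nsmul (Finset.range t) _ 1
      fun s _ => ψ.normCol_le_one k.1 (J (s + 1) k.1 ω) k.2

/-- The indices `J` need not be measurable for the history, but the picked column is recovered from
two consecutive messages. -/
theorem measurable_noise (k : G.Dart × X) (s : ℕ) :
    Measurable[historyFiltration h.measurable_messages (s + 1)] (noise ψ m J k s) := by
  set ℱ := historyFiltration h.measurable_messages
  have h1 : ∀ t ≤ s + 1, Measurable[ℱ (s + 1)] fun ω => m t ω k := fun t ht =>
    (measurable_pi_apply k).comp (measurable_history h.measurable_messages ht)
  have h2 : noise ψ m J k s = fun ω => ((s : ℝ) + 1) * m (s + 1) ω k - s * m s ω k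
      - ψ.bpUpdate (m s ω) k := by
    ext ω
    rw [h.mul_message_succ, noise]
    ring
  rw [h2]
  exact (((h1 _ le_rfl).const_mul _).sub ((h1 _ s.le_succ).const_mul _)).sub
    ((h.measurable_bpUpdate_history k s).mono (ℱ.mono s.le_succ) le_rfl)

theorem ae_tendsto (hG : G.IsAcyclic) {c : ℝ} (hc0 : 0 < c) (hc : ∀ e j i, c ≤ ψ.normCol e j i)
    {x : Messages G X} (hx : ψ.bpUpdate x = x) :
    ∀ᵐ ω ∂μ, Tendsto (fun t : ℕ => m t ω) atTop (𝓝 x) := by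
  have hpos := fun k => hc0.trans_le ((ψ.mem_Icc_of_isFixedPt hG hc0 hc hx).1 k)
  have hnoise : ∀ᵐ ω ∂μ, ∀ k,
      Tendsto (fun n : ℕ => (∑ s ∈ Finset.range n, noise ψ m J k s ω) / n) atTop (𝓝 0) :=
    ae_all_iff.2 fun k => ae_tendsto_sum_div (h.measurable_noise k) (h.ae_abs_noise_le k)
      (h.condExp_noise k)
  filter_upwards [hnoise] with ω hω
  rw [tendsto_pi_nhds]
  rintro ⟨e, i⟩
  refine dart_induction hG (P := fun e => ∀ i, Tendsto (fun t => m t ω (e, i)) atTop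
    (𝓝 (x (e, i)))) ?_ e i
  intro e he i
  have h1 := (ψ.tendsto_bpUpdate (m := fun t => m t ω) (fun f _ j => hpos (f, j)) he i).cesaro
  have h2 := (hω (e, i)).add h1
  rw [hx, zero_add] at h2
  refine h2.congr' ?_
  filter_upwards [eventually_gt_atTop 0] with t ht
  have ht' : (t : ℝ) ≠ 0 := by positivity
  rw [div_eq_inv_mul, ← mul_add, ← h.mul_message_eq_noise_add, inv_mul_cancel_left₀ ht']

theorem integrable_abs_sub {c : ℝ} (hc0 : 0 < c) (hc : ∀ e j i, c ≤ ψ.normCol e j i)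
    {x : Messages G X} (hx : x ∈ Set.Icc (fun _ => c) (fun _ => (1 : ℝ))) {t : ℕ} (ht : 1 ≤ t)
    (k : G.Dart × X) : Integrable (fun ω => |m t ω k - x k|) μ := by
  have hm : Measurable fun ω => |m t ω k - x k| :=
    (((measurable_pi_apply k).comp (h.measurable_messages t)).sub_const _).abs
  refine integrable_of_ae_abs_le hm (C := 1) (ae_of_all _ fun ω => ?_)
  have hb := h.message_mem_Icc hc ht ω
  rw [abs_abs]
  exact abs_sub_le_of_nonneg_of_le (hc0.le.trans (hb.1 k)) (hb.2 k) (hc0.le.trans (hx.1 k)) (hx.2 k)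

theorem mul_integral_abs_sub_le {c : ℝ} (hc0 : 0 < c)
    (hc : ∀ e j i, c ≤ ψ.normCol e j i) {x : Messages G X}
    (hx : x ∈ Set.Icc (fun _ => c) (fun _ => (1 : ℝ))) (hfix : ψ.bpUpdate x = x)
    {A : Matrix (G.Dart × X) (G.Dart × X) ℝ}
    (hA : ∀ m ∈ Set.Icc (fun _ => c) (fun _ => (1 : ℝ)),
      ∀ m' ∈ Set.Icc (fun _ => c) (fun _ => (1 : ℝ)),
        ∀ k, |ψ.bpUpdate m k - ψ.bpUpdate m' k| ≤ (A *ᵥ fun l => |m l - m' l|) k)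
    {t : ℕ} (ht : 1 ≤ t) (k : G.Dart × X) :
    t * ∫ ω, |m t ω k - x k| ∂μ ≤ √(t : ℝ) + 1
      + ∑ s ∈ Finset.Ico 1 t, (A *ᵥ fun l => ∫ ω, |m s ω l - x l| ∂μ) k := by
  have ht' : (0 : ℝ) < t := by exact_mod_cast ht
  have hmeas : ∀ s, Measurable (noise ψ m J k s) := fun s =>
    (h.measurable_noise k s).mono ((historyFiltration h.measurable_messages).le _) le_rfl
  have hSi : Integrable (fun ω => |∑ s ∈ Finset.range t, noise ψ m J k s ω|) μ := by
    refine integrable_of_ae_abs_le (Finset.measurable_sum _ fun s _ => hmeas s).abs (C := t) ?_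
    filter_upwards [h.ae_abs_noise_le k] with ω hω
    rw [abs_abs]
    exact abs_sum_range_le hω t
  have hAi : ∀ s ∈ Finset.Ico 1 t,
      Integrable (fun ω => (A *ᵥ fun l => |m s ω l - x l|) k) μ := fun s hs =>
    integrable_finsetSum _ fun l _ =>
      (h.integrable_abs_sub hc0 hc hx (Finset.mem_Ico.1 hs).1 l).const_mul _
  have hAint : ∀ s ∈ Finset.Ico 1 t, ∫ ω, (A *ᵥ fun l => |m s ω l - x l|) k ∂μ =
      (A *ᵥ fun l => ∫ ω, |m s ω l - x l| ∂μ) k := by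
    intro s hs
    simp only [Matrix.mulVec, dotProduct]
    rw [integral_finsetSum _ fun l _ =>
      (h.integrable_abs_sub hc0 hc hx (Finset.mem_Ico.1 hs).1 l).const_mul _]
    simp only [integral_const_mul]
  have hpt : ∀ᵐ ω ∂μ, t * |m t ω k - x k| ≤ |∑ s ∈ Finset.range t, noise ψ m J k s ω| + 1
      + ∑ s ∈ Finset.Ico 1 t, (A *ᵥ fun l => |m s ω l - x l|) k := by
    filter_upwards [h.ae_bpUpdate_mem_Icc 0 k] with ω hω
    have h1 : t * (m t ω k - x k) = ∑ s ∈ Finset.range t, noise ψ m J k s ω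
        + ∑ s ∈ Finset.range t, (ψ.bpUpdate (m s ω) k - x k) := by
      rw [mul_sub, h.mul_message_eq_noise_add, Finset.sum_sub_distrib]
      simp only [Finset.sum_const, Finset.card_range, nsmul_eq_mul]
      ring
    have h2 : |∑ s ∈ Finset.range t, (ψ.bpUpdate (m s ω) k - x k)| ≤
        1 + ∑ s ∈ Finset.Ico 1 t, (A *ᵥ fun l => |m s ω l - x l|) k := by
      -- The term `s = 0` is split off: `m 0` may lie outside the box, where the bound by `A` is
      -- unavailable, but the term is at most 1 since both values lie in [0, 1].
      rw [Finset.range_eq_Ico, Finset.sum_eq_sum_Ico_succ_bot ht]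
      refine (abs_add_le _ _).trans (add_le_add ?_ ?_)
      · exact abs_sub_le_of_nonneg_of_le hω.1 hω.2 (hc0.le.trans (hx.1 k)) (hx.2 k)
      · refine (Finset.abs_sum_le_sum_abs _ _).trans (Finset.sum_le_sum fun s hs => ?_)
        have := hA _ (h.message_mem_Icc hc (Finset.mem_Ico.1 hs).1 ω) x hx k
        rwa [hfix] at this
    calc t * |m t ω k - x k| = |t * (m t ω k - x k)| := by rw [abs_mul, abs_of_pos ht']
      _ ≤ _ := by
        rw [h1, add_assoc]
        exact (abs_add_le _ _).trans (add_le_add_right h2 _)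
  calc t * ∫ ω, |m t ω k - x k| ∂μ = ∫ ω, t * |m t ω k - x k| ∂μ := by rw [integral_const_mul]
    _ ≤ ∫ ω, (|∑ s ∈ Finset.range t, noise ψ m J k s ω| + 1
        + ∑ s ∈ Finset.Ico 1 t, (A *ᵥ fun l => |m s ω l - x l|) k) ∂μ :=
      integral_mono_ae ((h.integrable_abs_sub hc0 hc hx ht k).const_mul _)
        ((hSi.add (integrable_const 1)).add (integrable_finsetSum _ hAi)) hpt
    _ = ∫ ω, |∑ s ∈ Finset.range t, noise ψ m J k s ω| ∂μ + 1
        + ∑ s ∈ Finset.Ico 1 t, (A *ᵥ fun l => ∫ ω, |m s ω l - x l| ∂μ) k := by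
      rw [integral_add (f := fun ω => |∑ s ∈ Finset.range t, noise ψ m J k s ω| + 1)
        (hSi.add (integrable_const 1)) (integrable_finsetSum _ hAi),
        integral_add hSi (integrable_const 1), integral_finsetSum _ hAi, Finset.sum_congr rfl hAint]
      simp
    _ ≤ _ := by
      gcongr
      exact integral_abs_sum_le (h.measurable_noise k) (h.ae_abs_noise_le k) (h.condExp_noise k) t

end HarmonicSteps

end IsSBPRun

end PairwiseMRF

/-! ### Assembly of the theorem. -/

theorem theorem1 {V : Type*} [Fintype V] [DecidableEq V] (G : SimpleGraph V)
    [DecidableRel G.Adj] (hG : G.IsAcyclic) {X : Type*} [Fintype X] [DecidableEq X]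
    (ψ : PairwiseMRF G X) :
    ∃ mstar : Messages G X,
      (ψ.bpUpdate mstar = mstar ∧ ∀ m : Messages G X, ψ.bpUpdate m = m → m = mstar) ∧
      ∃ A : Matrix (G.Dart × X) (G.Dart × X) ℝ, A ^ longestPath G = 0 ∧
        ∀ (Ω : Type*) [MeasurableSpace Ω] (μ : Measure Ω) [IsProbabilityMeasure μ]
          (m : ℕ → Ω → Messages G X) (J : ℕ → G.Dart → Ω → X),
          ψ.IsSBPRun (fun t : ℕ => 1 / ((t : ℝ) + 1)) μ m J →
          (∀ᵐ ω ∂μ, Tendsto (fun t : ℕ => m t ω) atTop (𝓝 mstar)) ∧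
          ∀ t : ℕ, 1 ≤ t → ∀ k : G.Dart × X,
            Integrable (fun ω => |m t ω k - mstar k|) μ ∧
            ∫ ω, |m t ω k - mstar k| ∂μ ≤
              ((4 : ℝ) • ((1 - (2 : ℝ) • A)⁻¹ *ᵥ fun _ => 1 / √(t : ℝ))) k := by
  obtain ⟨c, hc0, hc1, hc⟩ := ψ.exists_pos_le_normCol
  obtain ⟨A, hA0, hAs, hA⟩ := ψ.exists_matrix_bound hc0
  have hAr := pow_longestPath_eq_zero hG A hAs
  obtain ⟨x, hxK, hx, hxu⟩ := PairwiseMRF.existsUnique_fixedPoint_of_nilpotent hA0 hAr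
    (K := Set.Icc (fun _ => c) (fun _ => (1 : ℝ))) ⟨fun _ => 1, fun _ => hc1, fun _ => le_rfl⟩
    (F := ψ.bpUpdate)
    (fun m hm =>
      have hk := fun k : G.Dart × X =>
        ψ.bpUpdate_mem_Icc hc (m := m) (fun f _ j => hc0.trans_le (hm.1 (f, j))) k.2
      ⟨fun k => (hk k).1, fun k => (hk k).2⟩) hA
  refine ⟨x, ⟨hx, fun m hm => hxu m (ψ.mem_Icc_of_isFixedPt hG hc0 hc hm) hm⟩, A, hAr, ?_⟩
  intro Ω _ μ _ m J h
  refine ⟨h.ae_tendsto hG hc0 hc hx, fun t ht k => ⟨h.integrable_abs_sub hc0 hc hxK ht k, ?_⟩⟩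
  have hBr : ((2 : ℝ) • A) ^ longestPath G = 0 := by rw [smul_pow, hAr, smul_zero]
  -- Nonnegative powers make the finite Neumann series for `(1 - 2A)⁻¹` nonnegative, hence also `b`.
  have hB0 : ∀ n k l, 0 ≤ (((2 : ℝ) • A) ^ n) k l := by
    intro n
    induction n with
    | zero =>
      intro k l
      rw [pow_zero, Matrix.one_apply]
      split_ifs <;> simp
    | succ n ih =>
      intro k l
      rw [pow_succ, Matrix.mul_apply]
      exact Finset.sum_nonneg fun j _ => mul_nonneg (ih k j) (mul_nonneg zero_le_two (hA0 j l))
  have hinv := inv_one_sub_eq_geom_sum hBr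
  have hcan : (1 - (2 : ℝ) • A) * (1 - (2 : ℝ) • A)⁻¹ = 1 := by
    rw [hinv, mul_neg_geom_sum, hBr, sub_zero]
  have hI0 : ∀ k l, 0 ≤ ((1 - (2 : ℝ) • A)⁻¹) k l := fun k l => by
    rw [hinv, Matrix.sum_apply]
    exact Finset.sum_nonneg fun n _ => hB0 n k l
  set b : G.Dart × X → ℝ := (1 - (2 : ℝ) • A)⁻¹ *ᵥ fun _ => 2 with hb
  have hb0 : ∀ k, 0 ≤ b k := fun k =>
    Finset.sum_nonneg fun l _ => mul_nonneg (hI0 k l) zero_le_two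
  have hbe : ∀ k, b k = 2 + 2 * (A *ᵥ b) k := by
    intro k
    have h1 : (1 - (2 : ℝ) • A) *ᵥ b = fun _ => 2 := by
      rw [hb, Matrix.mulVec_mulVec, hcan, Matrix.one_mulVec]
    have h2 := congrFun h1 k
    rw [Matrix.sub_mulVec, Matrix.one_mulVec, Matrix.smul_mulVec, Pi.sub_apply, Pi.smul_apply,
      smul_eq_mul] at h2
    linarith
  have hle := error_le_of_recursion hA0 hb0 hbe
    (e := fun t k => ∫ ω, |m t ω k - x k| ∂μ)
    (fun t ht k => h.mul_integral_abs_sub_le hc0 hc hxK hx hA ht k) t ht k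
  refine hle.trans ?_
  have h4 : ((4 : ℝ) • ((1 - (2 : ℝ) • A)⁻¹ *ᵥ fun _ => 1 / √(t : ℝ))) k
      = 2 * (b k / √(t : ℝ)) := by
    simp only [hb, Pi.smul_apply, Matrix.mulVec, dotProduct, smul_eq_mul, Finset.mul_sum,
      Finset.sum_div]
    exact Finset.sum_congr rfl fun l _ => by ring
  -- The claimed bound is twice the one obtained, so nonnegativity finishes.
  rw [h4]
  have : 0 ≤ b k / √(t : ℝ) := div_nonneg (hb0 k) (Real.sqrt_nonneg _)
  linarith
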